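/- Let $X$ be a real separated (Hausdorff) locally convex space with topological dual $X^*$, and let $X^*$ carry any locally convex vector space topology compatible with the duality pair $(X,X^*)$, i.e. one whose continuous linear functionals are exactly the evaluations $x^*\mapsto\langle x^*,x\rangle$, $x\in X$ (for example the weak* topology). Let $T$ be a nonempty set, let $c,a_t\in X^*$ and $b_t\in\mathbb R$ for $t\in T$, and consider the linear infinite program $$(\mathrm{PL})\qquad \inf\ \langle c,x\rangle\quad\text{s.t.}\quad \langle a_t,x\rangle\le b_t,\ t\in T.$$ Put $f:=\sup_{t\in T}(\langle a_t,\cdot\rangle-b_t)$ and $T_\varepsilon(x):=\{t\in T:\langle a_t,x\rangle-b_t\ge f(x)-\varepsilon\}$ for $\varepsilon>0$. Here $\overline{\mathrm{co}}$ denotes the closed convex hull in $X^*$, and the recession cone of a nonempty closed convex set $A$ is $[A]_\infty:=\bigcap_{s>0}s(A-a)$, where $a\in A$ is arbitrary. Assume the Slater condition: there is $x_0\in X$ with $f(x_0)<0$. Let $x$ be a feasible point of $(\mathrm{PL})$ (so that $f(x)$ is a real number and $f(x)\le0$). Then $x$ is optimal for $(\mathrm{PL})$ if and only if both of the following hold: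 (a) if $f(x)<0$, then $$-c\in\left[\overline{\mathrm{co}}\left\{\frac{\varepsilon\,a_t}{\max\{2f(x)-2(\langle a_t,x\rangle-b_t)-\varepsilon,\ \varepsilon\}}:t\in T\right\}\right]_\infty\quad\text{for all }\varepsilon>0;\tag{1}$$ (b) if $f(x)=0$, then either (1) holds, or there exists $\lambda>0$ such that $$-\lambda c\in\bigcap_{\varepsilon>0}\overline{\mathrm{co}}\left(\{a_t:t\in T_\varepsilon(x)\}+\left(\left\{\frac{-\varepsilon^2a_t}{2(\langle a_t,x\rangle-b_t)-2f(x)+\varepsilon}:t\in T\setminus T_\varepsilon(x)\right\}\cup\{0\}\right)\right).$$ -/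

import Mathlib

open Set Topology
open scoped Pointwise

namespace LinearInfiniteProgram

/-- A topology `τ` on the dual `X*` is compatible with the duality pair `(X, X*)` if it is a locally
convex vector space topology whose continuous linear functionals are exactly the evaluations
`x* ↦ ⟨x*, x⟩` at the points `x` of `X`. -/
structure IsCompatibleTopology {X : Type*} [AddCommGroup X] [Module ℝ X] [TopologicalSpace X]
    (τ : TopologicalSpace (StrongDual ℝ X)) : Prop where
  isTopologicalAddGroup : @IsTopologicalAddGroup (StrongDual ℝ X) τ _
  continuousSMul : @ContinuousSMul ℝ (StrongDual ℝ X) _ _ τ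
  locallyConvexSpace : @LocallyConvexSpace ℝ (StrongDual ℝ X) _ _ _ _ τ
  continuous_iff : ∀ φ : StrongDual ℝ X →ₗ[ℝ] ℝ,
    Continuous[τ, inferInstance] φ ↔ ∃ x : X, ∀ p : StrongDual ℝ X, φ p = p x

/-- The closed convex hull of `S` with respect to the topology `τ`. -/
def closedCo {E : Type*} [AddCommGroup E] [Module ℝ E] (τ : TopologicalSpace E) (S : Set E) :
    Set E :=
  closure[τ] (convexHull ℝ S)

open Classical in
/-- The recession cone `⋂_{t > 0} t (A - a)`, `a ∈ A`, of a closed convex set `A`; for a nonempty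
closed convex set it does not depend on the choice of the base point `a`. The recession cone of the
empty set is `{0}` by convention. -/
def recessionCone {E : Type*} [AddCommGroup E] [Module ℝ E] (A : Set E) : Set E :=
  if A.Nonempty then {v | ∃ a ∈ A, ∀ t : ℝ, 0 < t → v ∈ t • (A - {a})} else {0}

section Program

variable {X T : Type*} [AddCommGroup X] [Module ℝ X] [TopologicalSpace X]

/-- The constraint function `f_t = ⟨a_t, ·⟩ - b_t`. -/
def constraint (a : T → StrongDual ℝ X) (b : T → ℝ) (t : T) (x : X) : ℝ := a t x - b t

/-- The supremum function `f = sup_t (⟨a_t, ·⟩ - b_t)`, with extended real values. -/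
noncomputable def supFn (a : T → StrongDual ℝ X) (b : T → ℝ) (x : X) : EReal :=
  ⨆ t, (constraint a b t x : EReal)

/-- The feasible set `{x | ⟨a_t, x⟩ ≤ b_t for all t}`. -/
def feasibleSet (a : T → StrongDual ℝ X) (b : T → ℝ) : Set X := {x | ∀ t, a t x ≤ b t}

/-- The point `x` is optimal for minimizing `⟨c, ·⟩` over the feasible set. -/
def IsOptimal (c : StrongDual ℝ X) (a : T → StrongDual ℝ X) (b : T → ℝ) (x : X) : Prop :=
  x ∈ feasibleSet a b ∧ IsMinOn (fun y => c y) (feasibleSet a b) x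

/-- The Slater condition: `f x₀ < 0` for some `x₀` (the supremum itself is negative). -/
def Slater (a : T → StrongDual ℝ X) (b : T → ℝ) : Prop := ∃ x₀ : X, supFn a b x₀ < 0

/-- The set `T_ε(x)` of `ε`-active indices: `f_t(x) ≥ f(x) - ε`. -/
def activeSet (a : T → StrongDual ℝ X) (b : T → ℝ) (ε : ℝ) (x : X) : Set T :=
  {t | supFn a b x - (ε : EReal) ≤ (constraint a b t x : EReal)}

/-- The set of all `ε a_t / max {2 f(x) - 2 f_t(x) - ε, ε}`, `t ∈ T`. It is used only at feasible
points `x`, with `T` nonempty, where `f(x)` is a real number. -/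
noncomputable def weightedSet (a : T → StrongDual ℝ X) (b : T → ℝ) (ε : ℝ) (x : X) :
    Set (StrongDual ℝ X) :=
  range fun t => (ε / max (2 * (supFn a b x).toReal - 2 * constraint a b t x - ε) ε) • a t

/-- The set of all `-ε² a_t / (2 f_t(x) - 2 f(x) + ε)`, `t ∉ T_ε(x)`. It is used only at feasible
points `x`, with `T` nonempty, where `f(x)` is a real number. -/
noncomputable def penalizedSet (a : T → StrongDual ℝ X) (b : T → ℝ) (ε : ℝ) (x : X) :
    Set (StrongDual ℝ X) :=
  (fun t => (-ε ^ 2 / (2 * constraint a b t x - 2 * (supFn a b x).toReal + ε)) • a t) ''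
    (activeSet a b ε x)ᶜ

/-- The first condition: `-c` lies in the recession cone of the closed convex hull of the weighted
`a_t`, for every `ε > 0`. -/
def RecessionCondition (τ : TopologicalSpace (StrongDual ℝ X)) (c : StrongDual ℝ X)
    (a : T → StrongDual ℝ X) (b : T → ℝ) (x : X) : Prop :=
  ∀ ε : ℝ, 0 < ε → -c ∈ recessionCone (closedCo τ (weightedSet a b ε x))

/-- The second condition: for some `λ > 0`, `-λ c` lies in the intersection over `ε > 0` of the closed
convex hulls of `{a_t : t ∈ T_ε(x)} + ({penalized a_t : t ∉ T_ε(x)} ∪ {0})`. -/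
def MultiplierCondition (τ : TopologicalSpace (StrongDual ℝ X)) (c : StrongDual ℝ X)
    (a : T → StrongDual ℝ X) (b : T → ℝ) (x : X) : Prop :=
  ∃ l : ℝ, 0 < l ∧ -(l • c) ∈
    ⋂ (ε : ℝ) (_ : 0 < ε), closedCo τ (a '' activeSet a b ε x + (penalizedSet a b ε x ∪ {0}))

end Program

end LinearInfiniteProgram

/-! By Hahn–Banach, the closed convex hulls are determined by their support functions at the points
of `X`. Computing these shows that the recession condition says that `x` minimizes `c` over the
effective domain of `f`, and that the intersection in the multiplier condition is the
subdifferential of `f` at `x`. The Slater condition provides `μ ≥ 0` such that an optimal `x`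
minimizes `c + μ f` on the effective domain, and complementary slackness, `μ f(x) = 0`, separates
the cases: `μ = 0` gives the recession condition, `μ > 0` the multiplier condition with
`λ = μ⁻¹`. -/

namespace LinearInfiniteProgram

section SupportFunction

variable {E : Type*} [AddCommGroup E] [Module ℝ E]

theorem mem_closedCo_iff_forall_dual [τ : TopologicalSpace E] [IsTopologicalAddGroup E]
    [ContinuousSMul ℝ E] [LocallyConvexSpace ℝ E] {S : Set E} {v : E} :
    v ∈ closedCo τ S ↔ ∀ (φ : StrongDual ℝ E) (M : ℝ), (∀ s ∈ S, φ s ≤ M) → φ v ≤ M := by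
  constructor
  · intro hv φ M hM
    have hconv : Convex ℝ {p : E | φ p ≤ M} := convex_halfSpace_le φ.toLinearMap.isLinear M
    have hclosed : IsClosed {p : E | φ p ≤ M} := isClosed_le φ.continuous continuous_const
    exact closure_minimal (convexHull_min hM hconv) hclosed hv
  · intro h
    by_contra hv
    obtain ⟨φ, u, hu, huv⟩ := geometric_hahn_banach_closed_point
      (convex_convexHull ℝ S).closure isClosed_closure hv
    exact huv.not_ge (h φ u fun s hs => (hu s (subset_closure (subset_convexHull ℝ S hs))).le)

theorem mem_recessionCone_iff {A : Set E} (hA : A.Nonempty) {v : E} :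
    v ∈ recessionCone A ↔ ∃ p ∈ A, ∀ r : ℝ, 0 < r → p + r • v ∈ A := by
  have hmem (p : E) (r : ℝ) (hr : 0 < r) : v ∈ r • (A - {p}) ↔ p + r⁻¹ • v ∈ A := by
    rw [mem_smul_set_iff_inv_smul_mem₀ hr.ne', sub_singleton, mem_image]
    simp only [sub_eq_iff_eq_add', exists_eq_right]
  rw [recessionCone, if_pos hA]
  refine exists_congr fun p => and_congr_right fun _ => ⟨fun h r hr => ?_, fun h r hr => ?_⟩
  · simpa only [inv_inv] using (hmem p r⁻¹ (inv_pos.mpr hr)).mp (h r⁻¹ (inv_pos.mpr hr))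
  · exact (hmem p r hr).mpr (h r⁻¹ (inv_pos.mpr hr))

theorem nonpos_of_forall_add_mul_le {p v M : ℝ} (h : ∀ r : ℝ, 0 < r → p + r * v ≤ M) :
    v ≤ 0 := by
  by_contra! hv
  have hbound := h ((|M - p| + 1) / v) (by positivity)
  rw [div_mul_cancel₀ _ hv.ne'] at hbound
  linarith [le_abs_self (M - p)]

theorem mem_recessionCone_closedCo_iff_forall_dual [τ : TopologicalSpace E]
    [IsTopologicalAddGroup E] [ContinuousSMul ℝ E] [LocallyConvexSpace ℝ E] {S : Set E}
    (hS : S.Nonempty) {v : E} :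
    v ∈ recessionCone (closedCo τ S) ↔
      ∀ φ : StrongDual ℝ E, BddAbove (φ '' S) → φ v ≤ 0 := by
  obtain ⟨p, hp⟩ := hS
  have hpA : p ∈ closedCo τ S := subset_closure (subset_convexHull ℝ S hp)
  rw [mem_recessionCone_iff ⟨p, hpA⟩]
  constructor
  · rintro ⟨q, -, hq⟩ φ ⟨M, hM⟩
    refine nonpos_of_forall_add_mul_le (p := φ q) (M := M) fun r hr => ?_
    simpa using mem_closedCo_iff_forall_dual.mp (hq r hr) φ M fun s hs =>
      hM (mem_image_of_mem φ hs)
  · refine fun h => ⟨p, hpA, fun r hr => mem_closedCo_iff_forall_dual.mpr fun φ M hM => ?_⟩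
    have hv : φ v ≤ 0 := h φ ⟨M, forall_mem_image.mpr hM⟩
    rw [map_add, map_smul, smul_eq_mul]
    linarith [hM p hp, mul_nonpos_of_nonneg_of_nonpos hr.le hv]

end SupportFunction

section CompatibleTopology

variable {X : Type*} [AddCommGroup X] [Module ℝ X] [TopologicalSpace X]
  {τ : TopologicalSpace (StrongDual ℝ X)} {S : Set (StrongDual ℝ X)} {v : StrongDual ℝ X}

theorem IsCompatibleTopology.forall_dual_iff (hτ : IsCompatibleTopology τ)
    {P : (StrongDual ℝ X → ℝ) → Prop} :
    (∀ φ : @StrongDual ℝ _ _ (StrongDual ℝ X) τ _ _, P φ) ↔ ∀ d : X, P fun p => p d := by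
  constructor
  · intro h d
    let eval : StrongDual ℝ X →ₗ[ℝ] ℝ :=
      { toFun := fun p => p d, map_add' := fun _ _ => rfl, map_smul' := fun _ _ => rfl }
    exact h (@ContinuousLinearMap.mk _ _ _ _ _ _ τ _ _ _ _ _ _ eval
      ((hτ.continuous_iff eval).mpr ⟨d, fun _ => rfl⟩))
  · intro h φ
    obtain ⟨d, hd⟩ := (hτ.continuous_iff φ.toLinearMap).mp φ.cont
    exact (funext hd : ⇑φ = fun p => p d) ▸ h d

theorem IsCompatibleTopology.mem_closedCo_iff (hτ : IsCompatibleTopology τ) :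
    v ∈ closedCo τ S ↔ ∀ (d : X) (M : ℝ), (∀ s ∈ S, s d ≤ M) → v d ≤ M :=
  (@mem_closedCo_iff_forall_dual _ _ _ τ hτ.isTopologicalAddGroup hτ.continuousSMul
    hτ.locallyConvexSpace S v).trans <|
    hτ.forall_dual_iff (P := fun φ => ∀ M : ℝ, (∀ s ∈ S, φ s ≤ M) → φ v ≤ M)

theorem IsCompatibleTopology.mem_recessionCone_closedCo_iff (hτ : IsCompatibleTopology τ)
    (hS : S.Nonempty) :
    v ∈ recessionCone (closedCo τ S) ↔ ∀ d : X, BddAbove ((fun s => s d) '' S) → v d ≤ 0 :=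
  (@mem_recessionCone_closedCo_iff_forall_dual _ _ _ τ hτ.isTopologicalAddGroup
    hτ.continuousSMul hτ.locallyConvexSpace S hS v).trans <|
    hτ.forall_dual_iff (P := fun φ => BddAbove (φ '' S) → φ v ≤ 0)

end CompatibleTopology

section RealEstimates

variable {ι : Type*} {g α : ι → ℝ} {ε : ℝ}

theorem bddAbove_weighted_iff (hε : 0 < ε) (hg : ∀ i, 0 ≤ g i) :
    BddAbove (range fun i => ε / max (2 * g i - ε) ε * α i) ↔
      ∃ s > 0, BddAbove (range fun i => s * α i - g i) := by
  have hmax_pos (i) : 0 < max (2 * g i - ε) ε := hε.trans_le (le_max_right _ _)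
  simp only [bddAbove_def, forall_mem_range]
  constructor
  · rintro ⟨M, hM⟩
    refine ⟨ε / (2 * (|M| + 1)), by positivity, ε / 2, fun i => ?_⟩
    have hα : ε * α i ≤ (|M| + 1) * (2 * g i + ε) := by
      have hMi := hM i
      rw [div_mul_eq_mul_div, div_le_iff₀ (hmax_pos i)] at hMi
      exact hMi.trans <| mul_le_mul (by linarith [le_abs_self M])
        (max_le (by linarith) (by linarith [hg i])) (hmax_pos i).le (by positivity)
    have hscaled : ε / (2 * (|M| + 1)) * α i ≤ g i + ε / 2 := by
      rw [div_mul_eq_mul_div, div_le_iff₀ (by positivity)]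
      linarith
    linarith
  · rintro ⟨s, hs, r, hr⟩
    refine ⟨(ε + |r|) / s, fun i => ?_⟩
    rw [div_mul_eq_mul_div, div_le_div_iff₀ (hmax_pos i) hs]
    set m := max (2 * g i - ε) ε
    have hm : 2 * g i - ε ≤ m := le_max_left _ _
    have hεm : ε ≤ m := le_max_right _ _
    calc ε * α i * s = ε * (s * α i) := by ring
      _ ≤ ε * (m + |r|) := by
        gcongr
        linarith [hr i, le_abs_self r]
      _ = ε * m + ε * |r| := mul_add _ _ _
      _ ≤ ε * m + m * |r| := by gcongr
      _ = (ε + |r|) * m := by ring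

theorem sq_div_mul_le {γ β δ : ℝ} (hε : 0 < ε) (hγ : ε < γ) (hβ : β ≤ δ + γ) :
    ε ^ 2 / (2 * γ - ε) * β ≤ ε * (|δ| + ε) := by
  have hden : 0 < 2 * γ - ε := by linarith
  have hk_le : ε ^ 2 / (2 * γ - ε) ≤ ε := by
    rw [div_le_iff₀ hden, sq]
    gcongr
    linarith
  have hkγ_le : ε ^ 2 / (2 * γ - ε) * γ ≤ ε ^ 2 := by
    rw [div_mul_eq_mul_div, div_le_iff₀ hden]
    gcongr
    linarith
  set k := ε ^ 2 / (2 * γ - ε)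
  have : 0 ≤ k := by positivity
  calc k * β ≤ k * (|δ| + γ) := by
        gcongr
        linarith [le_abs_self δ]
    _ = k * |δ| + k * γ := mul_add _ _ _
    _ ≤ ε * |δ| + ε ^ 2 := by gcongr
    _ = ε * (|δ| + ε) := by ring

theorem exists_pos_forall_mul_le {M ρ : ℝ} (hε : 0 < ε) (hg : ∀ i, 0 ≤ g i)
    (hsmall : ∀ i, g i ≤ ε → α i ≤ M)
    (hlarge : ∀ i, ε < g i → ε ^ 2 / (2 * g i - ε) * α i ≤ ρ) :
    ∃ s > 0, ∀ i, s * α i ≤ g i + s * M := by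
  obtain ⟨s, hs, hsmul⟩ := exists_pos_mul_lt (show 0 < ε ^ 2 / 2 by positivity) (|ρ| + ε * |M|)
  have hsρ : s * ρ ≤ ε ^ 2 / 2 := by
    nlinarith [le_abs_self ρ, mul_nonneg hε.le (mul_nonneg (abs_nonneg M) hs.le)]
  have hsM : -(ε / 2) ≤ s * M := by
    refine le_of_mul_le_mul_left ?_ hε
    nlinarith [neg_abs_le M, mul_nonneg (abs_nonneg ρ) hs.le, mul_pos hε hs]
  refine ⟨s, hs, fun i => ?_⟩
  rcases le_or_gt (g i) ε with hi | hi
  · linarith [hg i, mul_le_mul_of_nonneg_left (hsmall i hi) hs.le]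
  · have hden : 0 < 2 * g i - ε := by linarith
    have hscaled : ε ^ 2 * (s * α i) ≤ ε ^ 2 * (g i - ε / 2) := by
      have hρ := hlarge i hi
      rw [div_mul_eq_mul_div, div_le_iff₀ hden] at hρ
      calc ε ^ 2 * (s * α i) = s * (ε ^ 2 * α i) := by ring
        _ ≤ s * (ρ * (2 * g i - ε)) := by gcongr
        _ = s * ρ * (2 * g i - ε) := by ring
        _ ≤ ε ^ 2 / 2 * (2 * g i - ε) := by gcongr
        _ = ε ^ 2 * (g i - ε / 2) := by ring
    linarith [le_of_mul_le_mul_left hscaled (by positivity)]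

theorem le_of_forall_pos_le_add_mul {z δ C : ℝ} (h : ∀ ε > 0, z ≤ δ + ε * (C + ε)) : z ≤ δ := by
  have hlim : Filter.Tendsto (fun ε : ℝ => δ + ε * (C + ε)) (𝓝[>] 0) (𝓝 δ) := by
    have hcont : Continuous fun ε : ℝ => δ + ε * (C + ε) := by fun_prop
    simpa using (hcont.tendsto 0).mono_left nhdsWithin_le_nhds
  exact ge_of_tendsto hlim (eventually_mem_nhdsWithin.mono h)

end RealEstimates

section ConvexMultiplier

variable {E : Type*} [AddCommGroup E] [Module ℝ E] {C : Set E} {f g : E → ℝ}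

theorem mul_le_mul_of_nonneg_on_sublevel (hf : ConvexOn ℝ C f) (hg : ConvexOn ℝ C g)
    (hnonneg : ∀ y ∈ C, f y ≤ 0 → 0 ≤ g y) {y z : E} (hy : y ∈ C) (hz : z ∈ C)
    (hfy : f y < 0) (hfz : 0 < f z) : -g z * -f y ≤ g y * f z := by
  -- The weights are chosen so that the convex bound for `f` at `w` vanishes.
  set s := f z - f y
  have hs : 0 < s := sub_pos.mpr (hfy.trans hfz)
  have hα : 0 ≤ f z / s := by positivity
  have hβ : 0 ≤ -f y / s := div_nonneg (by linarith) hs.le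
  have hαβ : f z / s + -f y / s = 1 := by
    rw [← add_div, ← sub_eq_add_neg, div_self hs.ne']
  set w := (f z / s) • y + (-f y / s) • z
  have hfw : f w ≤ 0 := (hf.2 hy hz hα hβ hαβ).trans_eq (by simp only [smul_eq_mul]; ring)
  have hgw : 0 ≤ (f z / s) * g y + (-f y / s) * g z :=
    (hnonneg w (hf.1 hy hz hα hβ hαβ) hfw).trans (hg.2 hy hz hα hβ hαβ)
  rw [div_mul_eq_mul_div, div_mul_eq_mul_div, ← add_div] at hgw
  linarith [(le_div_iff₀ hs).mp hgw]

theorem exists_multiplier_of_convexOn (hf : ConvexOn ℝ C f) (hg : ConvexOn ℝ C g)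
    (hslater : ∃ y ∈ C, f y < 0) (hnonneg : ∀ y ∈ C, f y ≤ 0 → 0 ≤ g y) :
    ∃ μ : ℝ, 0 ≤ μ ∧ ∀ y ∈ C, 0 ≤ g y + μ * f y := by
  -- Any `μ` above the bounds forced by `0 < f` and below those forced by `f < 0` will do.
  let lower : Set ℝ := insert 0 ((fun z => -g z / f z) '' {z ∈ C | 0 < f z})
  let upper : Set ℝ := (fun y => g y / -f y) '' {y ∈ C | f y < 0}
  have hle : ∀ l ∈ lower, ∀ u ∈ upper, l ≤ u := by
    rintro _ (rfl | ⟨z, ⟨hz, hfz⟩, rfl⟩) _ ⟨y, ⟨hy, hfy⟩, rfl⟩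
    · exact div_nonneg (hnonneg y hy hfy.le) (by linarith)
    · exact (div_le_div_iff₀ hfz (by linarith)).mpr
        (mul_le_mul_of_nonneg_on_sublevel hf hg hnonneg hy hz hfy hfz)
  obtain ⟨y₀, hy₀⟩ := hslater
  obtain ⟨μ, hμ_lower, hμ_upper⟩ := exists_between_of_forall_le
    (insert_nonempty 0 _ : lower.Nonempty) (Nonempty.image _ ⟨y₀, hy₀⟩ : upper.Nonempty) hle
  refine ⟨μ, hμ_lower (mem_insert _ _), fun y hy => ?_⟩
  rcases lt_trichotomy (f y) 0 with hfy | hfy | hfy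
  · have hμ := hμ_upper (mem_image_of_mem _ ⟨hy, hfy⟩)
    rw [le_div_iff₀ (by linarith)] at hμ
    linarith
  · simpa [hfy] using hnonneg y hy hfy.le
  · have hμ := hμ_lower (mem_insert_of_mem _ (mem_image_of_mem _ ⟨hy, hfy⟩))
    rw [div_le_iff₀ hfy] at hμ
    linarith

end ConvexMultiplier

/-- The effective domain of an extended-real-valued function; minimality over it is what the
recession condition expresses. -/
def effectiveDomain {E : Type*} (f : E → EReal) : Set E := {y | f y < ⊤}

theorem mem_effectiveDomain_iff_exists_le {E : Type*} {f : E → EReal} {x : E} :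
    x ∈ effectiveDomain f ↔ ∃ r : ℝ, f x ≤ r := by
  refine ⟨fun h => ?_, fun ⟨r, hr⟩ => hr.trans_lt (EReal.coe_lt_top r)⟩
  obtain ⟨r, hr, -⟩ := EReal.lt_iff_exists_real_btwn.mp h
  exact ⟨r, hr.le⟩

section Program

variable {X T : Type*} [AddCommGroup X] [Module ℝ X] [TopologicalSpace X]
  {a : T → StrongDual ℝ X} {b : T → ℝ} {x : X}

/-- The convex subdifferential of `f` at `x`, which the multiplier condition describes by closed
convex hulls. It is used only at points where `f x` is finite, so
that the sum in `EReal` involves no infinities. -/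
def subdifferential (f : X → EReal) (x : X) : Set (StrongDual ℝ X) :=
  {p | ∀ y, f x + (p (y - x) : ℝ) ≤ f y}

/-- The slack `f(x) - f_t(x)` of the constraint `t` relative to the supremum, in which the
weights of the generating sets are expressed. It is used only at points of the effective domain of
`f`, where `f(x)` is a real number. -/
noncomputable def gap (a : T → StrongDual ℝ X) (b : T → ℝ) (x : X) (t : T) : ℝ :=
  (supFn a b x).toReal - constraint a b t x

theorem supFn_le_coe_iff {r : ℝ} : supFn a b x ≤ (r : EReal) ↔ ∀ t, constraint a b t x ≤ r := by
  simp only [supFn, iSup_le_iff, EReal.coe_le_coe_iff]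

theorem mem_feasibleSet_iff : x ∈ feasibleSet a b ↔ supFn a b x ≤ 0 := by
  simp only [← EReal.coe_zero, supFn_le_coe_iff, feasibleSet, constraint, mem_ofPred_eq,
    sub_nonpos]

theorem feasibleSet_subset_effectiveDomain :
    feasibleSet a b ⊆ effectiveDomain (supFn a b) :=
  fun _ hy => (mem_feasibleSet_iff.mp hy).trans_lt EReal.zero_lt_top

theorem coe_toReal_supFn [Nonempty T] (hx : x ∈ effectiveDomain (supFn a b)) :
    ((supFn a b x).toReal : EReal) = supFn a b x := by
  obtain ⟨t⟩ := ‹Nonempty T›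
  have hle : (constraint a b t x : EReal) ≤ supFn a b x :=
    le_iSup (fun t => (constraint a b t x : EReal)) t
  exact EReal.coe_toReal (ne_of_lt hx) (ne_bot_of_le_ne_bot (EReal.coe_ne_bot _) hle)

theorem gap_nonneg [Nonempty T] (hx : x ∈ effectiveDomain (supFn a b)) (t : T) :
    0 ≤ gap a b x t :=
  sub_nonneg.mpr (supFn_le_coe_iff.mp (coe_toReal_supFn hx).ge t)

theorem exists_gap_le [Nonempty T] (hx : x ∈ effectiveDomain (supFn a b)) {ε : ℝ} (hε : 0 < ε) :
    ∃ t, gap a b x t ≤ ε := by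
  by_contra! hgap
  have hle : supFn a b x ≤ ((supFn a b x).toReal - ε : ℝ) :=
    supFn_le_coe_iff.mpr fun t => (lt_sub_comm.mp (hgap t)).le
  rw [← coe_toReal_supFn hx, EReal.coe_le_coe_iff, EReal.toReal_coe] at hle
  linarith

theorem supFn_add_smul_le_iff {s r : ℝ} {d : X} :
    supFn a b (x + s • d) ≤ (r : EReal) ↔
      ∀ t, s * a t d ≤ gap a b x t + (r - (supFn a b x).toReal) := by
  refine supFn_le_coe_iff.trans (forall_congr' fun t => ?_)
  simp only [gap, constraint, map_add, map_smul, smul_eq_mul]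
  constructor <;> intro h <;> linarith

theorem add_smul_mem_effectiveDomain_iff {s : ℝ} {d : X} :
    x + s • d ∈ effectiveDomain (supFn a b) ↔
      BddAbove (range fun t => s * a t d - gap a b x t) := by
  simp only [mem_effectiveDomain_iff_exists_le, supFn_add_smul_le_iff, bddAbove_def,
    forall_mem_range, sub_le_iff_le_add']
  exact (Equiv.subRight (supFn a b x).toReal).exists_congr_left.trans (by simp)

theorem mem_activeSet_iff [Nonempty T] (hx : x ∈ effectiveDomain (supFn a b)) {ε : ℝ} {t : T} :
    t ∈ activeSet a b ε x ↔ gap a b x t ≤ ε := by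
  rw [activeSet, mem_ofPred_eq, ← coe_toReal_supFn hx, ← EReal.coe_sub, EReal.coe_le_coe_iff, gap]
  exact sub_le_comm

theorem weightedSet_eq_range_gap {ε : ℝ} :
    weightedSet a b ε x = range fun t => (ε / max (2 * gap a b x t - ε) ε) • a t := by
  simp only [weightedSet, gap, mul_sub]

theorem penalizedSet_eq_image_gap [Nonempty T] (hx : x ∈ effectiveDomain (supFn a b)) {ε : ℝ} :
    penalizedSet a b ε x =
      (fun t => (ε ^ 2 / (2 * gap a b x t - ε)) • a t) '' {t | ε < gap a b x t} := by
  have hcompl : (activeSet a b ε x)ᶜ = {t | ε < gap a b x t} :=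
    ext fun t => (mem_activeSet_iff hx).not.trans not_le
  rw [penalizedSet, hcompl]
  refine image_congr fun t _ => ?_
  rw [gap, ← neg_div_neg_eq]
  ring_nf

variable {τ : TopologicalSpace (StrongDual ℝ X)} {c : StrongDual ℝ X}

theorem neg_mem_recessionCone_weightedSet_iff [Nonempty T] (hτ : IsCompatibleTopology τ)
    (hx : x ∈ effectiveDomain (supFn a b)) {ε : ℝ} (hε : 0 < ε) :
    -c ∈ recessionCone (closedCo τ (weightedSet a b ε x)) ↔
      IsMinOn c (effectiveDomain (supFn a b)) x := by
  have hbdd (d : X) : BddAbove ((fun p : StrongDual ℝ X => p d) '' weightedSet a b ε x) ↔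
      ∃ s > (0 : ℝ), x + s • d ∈ effectiveDomain (supFn a b) := by
    rw [weightedSet_eq_range_gap, ← range_comp]
    simp only [add_smul_mem_effectiveDomain_iff]
    exact bddAbove_weighted_iff hε (gap_nonneg hx)
  have hne : (weightedSet a b ε x).Nonempty := range_nonempty _
  rw [hτ.mem_recessionCone_closedCo_iff hne, isMinOn_iff]
  simp only [hbdd, neg_apply, neg_nonpos]
  constructor
  · intro h y hy
    have hdir : 0 ≤ c (y - x) := h (y - x) ⟨1, one_pos, by simpa using hy⟩
    simpa using hdir
  · rintro h d ⟨s, hs, hsd⟩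
    have hle : c x ≤ c x + s * c d := by simpa using h _ hsd
    exact nonneg_of_mul_nonneg_right (by linarith) hs

theorem recessionCondition_iff [Nonempty T] (hτ : IsCompatibleTopology τ)
    (hx : x ∈ effectiveDomain (supFn a b)) :
    RecessionCondition τ c a b x ↔ IsMinOn c (effectiveDomain (supFn a b)) x :=
  ⟨fun h => (neg_mem_recessionCone_weightedSet_iff hτ hx one_pos).mp (h 1 one_pos),
    fun h _ hε => (neg_mem_recessionCone_weightedSet_iff hτ hx hε).mpr h⟩

theorem mem_subdifferential_iff {f : X → EReal} {F : ℝ} (hF : f x = F) {p : StrongDual ℝ X} :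
    p ∈ subdifferential f x ↔ ∀ (y : X) (r : ℝ), f y ≤ r → p (y - x) ≤ r - F := by
  simp only [subdifferential, mem_ofPred_eq, hF, ← EReal.coe_add]
  refine forall_congr' fun y => ⟨fun h r hr => ?_, fun h => ?_⟩
  · linarith [EReal.coe_le_coe_iff.mp (h.trans hr)]
  · refine EReal.le_of_forall_lt_iff_le.mp fun r hr => EReal.coe_le_coe_iff.mpr ?_
    linarith [h r hr.le]

theorem apply_le_of_mem_activeSet_add [Nonempty T] (hx : x ∈ effectiveDomain (supFn a b))
    {ε δ : ℝ} (hε : 0 < ε) {d : X} (hd : ∀ t, a t d ≤ δ + gap a b x t) {p : StrongDual ℝ X}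
    (hp : p ∈ a '' activeSet a b ε x + (penalizedSet a b ε x ∪ {0})) :
    p d ≤ δ + ε * (1 + |δ| + ε) := by
  rw [penalizedSet_eq_image_gap hx] at hp
  obtain ⟨_, ⟨t, ht, rfl⟩, q, hq, rfl⟩ := mem_add.mp hp
  have ht_le : a t d ≤ δ + ε := by linarith [hd t, (mem_activeSet_iff hx).mp ht]
  have hq_le : q d ≤ ε * (|δ| + ε) := by
    rcases hq with ⟨u, hu, rfl⟩ | rfl
    · exact sq_div_mul_le hε hu (hd u)
    · rw [zero_apply]
      positivity
  rw [add_apply]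
  linarith

theorem iInter_closedCo_subset_subdifferential [Nonempty T] (hτ : IsCompatibleTopology τ)
    (hx : x ∈ effectiveDomain (supFn a b)) :
    ⋂ (ε : ℝ) (_ : 0 < ε), closedCo τ (a '' activeSet a b ε x + (penalizedSet a b ε x ∪ {0})) ⊆
      subdifferential (supFn a b) x := by
  intro p hp
  rw [mem_iInter₂] at hp
  refine (mem_subdifferential_iff (coe_toReal_supFn hx).symm).mpr fun y r hy => ?_
  have hdir : ∀ t, a t (y - x) ≤ r - (supFn a b x).toReal + gap a b x t := by
    have hle := supFn_add_smul_le_iff (x := x) (s := 1) (d := y - x) (r := r).mp (by simpa using hy)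
    exact fun t => by linarith [hle t]
  exact le_of_forall_pos_le_add_mul fun ε hε => hτ.mem_closedCo_iff.mp (hp ε hε) _ _ fun q hq =>
    apply_le_of_mem_activeSet_add hx hε hdir hq

theorem exists_supFn_add_smul_le [Nonempty T] (hx : x ∈ effectiveDomain (supFn a b))
    {ε M : ℝ} (hε : 0 < ε) {d : X}
    (hM : ∀ p ∈ a '' activeSet a b ε x + (penalizedSet a b ε x ∪ {0}), p d ≤ M) :
    ∃ s > (0 : ℝ), supFn a b (x + s • d) ≤ ((supFn a b x).toReal + s * M : ℝ) := by
  rw [penalizedSet_eq_image_gap hx] at hM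
  have hact (t) (ht : gap a b x t ≤ ε) : a t ∈ a '' activeSet a b ε x :=
    mem_image_of_mem a ((mem_activeSet_iff hx).mpr ht)
  obtain ⟨t₀, ht₀⟩ := exists_gap_le hx hε
  have hsmall (t) (ht : gap a b x t ≤ ε) : a t d ≤ M := by
    simpa using hM _ (add_mem_add (hact t ht) (Or.inr rfl))
  have hlarge (t) (ht : ε < gap a b x t) :
      ε ^ 2 / (2 * gap a b x t - ε) * a t d ≤ M - a t₀ d :=
    le_sub_iff_add_le'.mpr <|
      hM _ (add_mem_add (hact t₀ ht₀) (Or.inl (mem_image_of_mem _ ht)))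
  obtain ⟨s, hs, hle⟩ := exists_pos_forall_mul_le hε (gap_nonneg hx) hsmall hlarge
  exact ⟨s, hs, supFn_add_smul_le_iff.mpr (by simpa using hle)⟩

theorem subdifferential_subset_closedCo [Nonempty T] (hτ : IsCompatibleTopology τ)
    (hx : x ∈ effectiveDomain (supFn a b)) {ε : ℝ} (hε : 0 < ε) :
    subdifferential (supFn a b) x ⊆
      closedCo τ (a '' activeSet a b ε x + (penalizedSet a b ε x ∪ {0})) := by
  intro p hp
  refine hτ.mem_closedCo_iff.mpr fun d M hM => ?_
  obtain ⟨s, hs, hle⟩ := exists_supFn_add_smul_le hx hε hM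
  have hps := (mem_subdifferential_iff (coe_toReal_supFn hx).symm).mp hp _ _ hle
  rw [add_sub_cancel_left, map_smul, smul_eq_mul, add_sub_cancel_left] at hps
  exact le_of_mul_le_mul_left hps hs

theorem multiplierCondition_iff [Nonempty T] (hτ : IsCompatibleTopology τ)
    (hx : x ∈ effectiveDomain (supFn a b)) :
    MultiplierCondition τ c a b x ↔ ∃ l : ℝ, 0 < l ∧ -(l • c) ∈ subdifferential (supFn a b) x := by
  rw [MultiplierCondition, (iInter_closedCo_subset_subdifferential hτ hx).antisymm
    (subset_iInter₂ fun _ hε => subdifferential_subset_closedCo hτ hx hε)]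

theorem neg_smul_mem_subdifferential_iff (hx0 : supFn a b x = 0) {l : ℝ} :
    -(l • c) ∈ subdifferential (supFn a b) x ↔
      ∀ (y : X) (r : ℝ), supFn a b y ≤ r → l * (c x - c y) ≤ r := by
  rw [mem_subdifferential_iff (hx0.trans EReal.coe_zero.symm)]
  simp only [neg_apply, smul_apply, smul_eq_mul, map_sub, sub_zero, neg_sub_neg,
    mul_sub]

theorem isOptimal_of_isMinOn_effectiveDomain (hx : x ∈ feasibleSet a b)
    (h : IsMinOn c (effectiveDomain (supFn a b)) x) : IsOptimal c a b x :=
  ⟨hx, h.on_subset feasibleSet_subset_effectiveDomain⟩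

theorem isOptimal_of_neg_smul_mem_subdifferential (hx0 : supFn a b x = 0) {l : ℝ} (hl : 0 < l)
    (h : -(l • c) ∈ subdifferential (supFn a b) x) : IsOptimal c a b x := by
  refine ⟨mem_feasibleSet_iff.mpr hx0.le, isMinOn_iff.mpr fun y hy => ?_⟩
  have hle := (neg_smul_mem_subdifferential_iff hx0).mp h y 0 (mem_feasibleSet_iff.mp hy)
  linarith [nonpos_of_mul_nonpos_right hle hl]

theorem convex_epigraph_supFn : Convex ℝ {p : X × ℝ | supFn a b p.1 ≤ p.2} := by
  have heq : {p : X × ℝ | supFn a b p.1 ≤ p.2} = ⋂ t, {p : X × ℝ | a t p.1 - p.2 ≤ b t} := by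
    ext p
    simp only [mem_ofPred_eq, supFn_le_coe_iff, constraint, mem_iInter, sub_le_comm]
  rw [heq]
  exact convex_iInter fun t => convex_halfSpace_le
    ((a t).toLinearMap ∘ₗ LinearMap.fst ℝ X ℝ - LinearMap.snd ℝ X ℝ).isLinear (b t)

theorem IsOptimal.exists_multiplier (h : IsOptimal c a b x) (hSlater : Slater a b) :
    ∃ μ : ℝ, 0 ≤ μ ∧ ∀ (y : X) (r : ℝ), supFn a b y ≤ r → c x ≤ c y + μ * r := by
  have hf : ConvexOn ℝ {p : X × ℝ | supFn a b p.1 ≤ p.2} Prod.snd :=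
    (LinearMap.snd ℝ X ℝ).convexOn convex_epigraph_supFn
  have hg : ConvexOn ℝ {p : X × ℝ | supFn a b p.1 ≤ p.2} fun p => c p.1 + -c x :=
    ((c.toLinearMap ∘ₗ LinearMap.fst ℝ X ℝ).convexOn convex_epigraph_supFn).add_const _
  obtain ⟨x₀, hx₀⟩ := hSlater
  obtain ⟨r₀, hr₀, hr₀_neg⟩ := EReal.lt_iff_exists_real_btwn.mp hx₀
  obtain ⟨μ, hμ, hmin⟩ := exists_multiplier_of_convexOn hf hg
    ⟨(x₀, r₀), hr₀.le, EReal.coe_neg'.mp hr₀_neg⟩ fun p hp hp_nonpos => by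
      have hfeas : p.1 ∈ feasibleSet a b :=
        mem_feasibleSet_iff.mpr (hp.trans (EReal.coe_nonpos.mpr hp_nonpos))
      linarith [isMinOn_iff.mp h.2 _ hfeas]
  exact ⟨μ, hμ, fun y r hy => by linarith [hmin (y, r) hy]⟩

theorem isMinOn_effectiveDomain_of_forall_le
    (h : ∀ (y : X) (r : ℝ), supFn a b y ≤ r → c x ≤ c y) :
    IsMinOn c (effectiveDomain (supFn a b)) x :=
  isMinOn_iff.mpr fun y hy =>
    let ⟨r, hr⟩ := mem_effectiveDomain_iff_exists_le.mp hy
    h y r hr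

theorem IsOptimal.isMinOn_effectiveDomain_of_supFn_neg (h : IsOptimal c a b x)
    (hSlater : Slater a b) (hneg : supFn a b x < 0) :
    IsMinOn c (effectiveDomain (supFn a b)) x := by
  obtain ⟨μ, hμ, hmin⟩ := h.exists_multiplier hSlater
  obtain ⟨r, hr, hr_neg⟩ := EReal.lt_iff_exists_real_btwn.mp hneg
  have hμ0 : μ = 0 := by
    have hμr : 0 ≤ μ * r := by linarith [hmin x r hr.le]
    exact le_antisymm (nonpos_of_mul_nonneg_left hμr (EReal.coe_neg'.mp hr_neg)) hμ
  exact isMinOn_effectiveDomain_of_forall_le fun y q hy => by simpa [hμ0] using hmin y q hy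

theorem IsOptimal.isMinOn_effectiveDomain_or_exists_neg_smul_mem_subdifferential
    (h : IsOptimal c a b x) (hSlater : Slater a b) (hx0 : supFn a b x = 0) :
    IsMinOn c (effectiveDomain (supFn a b)) x ∨
      ∃ l : ℝ, 0 < l ∧ -(l • c) ∈ subdifferential (supFn a b) x := by
  obtain ⟨μ, hμ, hmin⟩ := h.exists_multiplier hSlater
  rcases hμ.eq_or_lt with rfl | hμ_pos
  · exact Or.inl <| isMinOn_effectiveDomain_of_forall_le fun y q hy => by simpa using hmin y q hy
  · refine Or.inr ⟨μ⁻¹, inv_pos.mpr hμ_pos, (neg_smul_mem_subdifferential_iff hx0).mpr ?_⟩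
    intro y r hy
    rw [inv_mul_le_iff₀ hμ_pos]
    linarith [hmin y r hy]

end Program

end LinearInfiniteProgram

open LinearInfiniteProgram

theorem corollary5p1_general {X T : Type*} [AddCommGroup X] [Module ℝ X] [TopologicalSpace X]
    [Nonempty T] (τ : TopologicalSpace (StrongDual ℝ X)) (hτ : IsCompatibleTopology τ)
    (c : StrongDual ℝ X) (a : T → StrongDual ℝ X) (b : T → ℝ) (hSlater : Slater a b)
    (x : X) (hx : x ∈ feasibleSet a b) :
    IsOptimal c a b x ↔
      (supFn a b x < 0 → RecessionCondition τ c a b x) ∧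
      (supFn a b x = 0 → RecessionCondition τ c a b x ∨ MultiplierCondition τ c a b x) := by
  have hdom := feasibleSet_subset_effectiveDomain hx
  rw [recessionCondition_iff hτ hdom, multiplierCondition_iff hτ hdom]
  constructor
  · intro h
    exact ⟨h.isMinOn_effectiveDomain_of_supFn_neg hSlater,
      h.isMinOn_effectiveDomain_or_exists_neg_smul_mem_subdifferential hSlater⟩
  · rintro ⟨hneg, hzero⟩
    rcases (mem_feasibleSet_iff.mp hx).lt_or_eq with hlt | hx0
    · exact isOptimal_of_isMinOn_effectiveDomain hx (hneg hlt)
    · rcases hzero hx0 with hmin | ⟨l, hl, hsub⟩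
      · exact isOptimal_of_isMinOn_effectiveDomain hx hmin
      · exact isOptimal_of_neg_smul_mem_subdifferential hx0 hl hsub

theorem corollary5p1 {X T : Type*} [AddCommGroup X] [Module ℝ X] [TopologicalSpace X]
    [IsTopologicalAddGroup X] [ContinuousSMul ℝ X] [LocallyConvexSpace ℝ X] [T2Space X]
    [Nonempty T]
    (τ : TopologicalSpace (StrongDual ℝ X)) (hτ : LinearInfiniteProgram.IsCompatibleTopology τ)
    (c : StrongDual ℝ X) (a : T → StrongDual ℝ X) (b : T → ℝ)
    (hSlater : LinearInfiniteProgram.Slater a b)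
    (x : X) (hx : x ∈ LinearInfiniteProgram.feasibleSet a b) :
    LinearInfiniteProgram.IsOptimal c a b x ↔
      (LinearInfiniteProgram.supFn a b x < 0 →
        LinearInfiniteProgram.RecessionCondition τ c a b x) ∧
      (LinearInfiniteProgram.supFn a b x = 0 →
        LinearInfiniteProgram.RecessionCondition τ c a b x ∨
        LinearInfiniteProgram.MultiplierCondition τ c a b x) :=
  corollary5p1_general τ hτ c a b hSlater x hx
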